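/- For $d\ge 1$ let $\mathbb{E}^d=(0,\infty)^d$ and $\min(\mathbf z)=\min_{1\le i\le d} z_i$. A random vector $\mathbf Z$ in $\mathbb{R}^d$ is called regularly varying on $\mathbb{E}^d$ with index $-\alpha<0$ and limit measure $\nu$ if $P(\min(\mathbf Z)>x)>0$ for all $x>0$; $\nu\neq 0$ is a Borel measure on $\mathbb{E}^d$ that is finite on $(x,\infty)^d$ for every $x>0$ and homogeneous of order $-\alpha$, that is, $\nu(cB)=c^{-\alpha}\nu(B)$ for all $c>0$ and all Borel sets $B\subset\mathbb{E}^d$; and $$\frac{P(\mathbf Z\in xB)}{P(\min(\mathbf Z)>x)}\longrightarrow \nu(B),\qquad x\to\infty,$$ for all Borel sets $B\subset\mathbb{E}^d$ with $\nu(\partial B)=0$ that are bounded away from the topological boundary of $\mathbb{E}^d$. Let $X_t=\sigma_t\varepsilon_t$, $t\in\mathbb{Z}$, where $(\sigma_t)_{t\in\mathbb{Z}}$ and $(\varepsilon_t)_{t\in\mathbb{Z}}$ are independent strictly stationary real time series, the $\varepsilon_t$, $t\in\mathbb{Z}$, are i.i.d., and $\sigma_t>0$ almost surely. Let $t_1,\dots,t_d\in\mathbb{Z}$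 and assume that $(\sigma_{t_1},\dots,\sigma_{t_d})$ is regularly varying on $\mathbb{E}^d$ with index $-\alpha_d<0$ and limit measure $\nu_d^\sigma$. Assume further that $0<E\big((\varepsilon_0^+)^{\alpha_d+\delta}\big)<\infty$ for some $\delta>0$, where $y^+=\max\{y,0\}$. Then $$0<E\Big(\nu_d^\sigma\Big(\times_{i=1}^d\Big(\frac{1}{\varepsilon_{t_i}^+},\infty\Big)\Big)\Big)<\infty,$$ and $(X_{t_1},\dots,X_{t_d})$ is regularly varying on $\mathbb{E}^d$ with the same index $-\alpha_d$ and with a limit measure $\nu_d^X$ that satisfies $$\nu_d^X\Big(\times_{i=1}^d(s_i,\infty)\Big)=\frac{E\Big(\nu_d^\sigma\Big(\times_{i=1}^d\Big(\frac{s_i}{\varepsilon_{t_i}^+},\infty\Big)\Big)\Big)}{E\Big(\nu_d^\sigma\Big(\times_{i=1}^d\Big(\frac{1}{\varepsilon_{t_i}^+},\infty\Big)\Big)\Big)}$$ for all $s_1,\dots,s_d>0$. Here $s/0=\infty$ for $s>0$ and $(\infty,\infty)=\emptyset$. -/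

import Mathlib

open Set Filter Topology MeasureTheory ProbabilityTheory
open scoped ENNReal Pointwise

namespace ConeRV

/-- The open cone `(0,∞)^d`. -/
def cone (d : ℕ) : Set (Fin d → ℝ) := {z | ∀ i, 0 < z i}

/-- The set `×_i (a_i, ∞)` for corners `a_i ∈ [0, ∞]`; it lies in the open cone, and it is empty
as soon as one `a_i` is infinite. -/
def upperBox {d : ℕ} (a : Fin d → ℝ≥0∞) : Set (Fin d → ℝ) :=
  {z | ∀ i, a i < ENNReal.ofReal (z i)}

/-- `B ⊆ (0,∞)^d` is bounded away from the topological boundary of the cone: the distance of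
a point `z` of the cone from that boundary is its smallest coordinate. -/
def BoundedAway {d : ℕ} (B : Set (Fin d → ℝ)) : Prop :=
  ∃ r : ℝ, 0 < r ∧ ∀ z ∈ B, ∀ i, r ≤ z i

/-- `Z` is regularly varying on the cone `(0,∞)^d` with index `-α < 0` and limit measure `ν`.
A measure on the cone is represented by a measure on `ℝ^d` that gives no mass to the complement of
the cone. The event `{min Z > x}` is written as `{ω | ∀ i, x < Z ω i}`. -/
structure RegularlyVarying {Ω : Type*} [MeasurableSpace Ω] (P : Measure Ω) {d : ℕ}
    (Z : Ω → Fin d → ℝ) (α : ℝ) (ν : Measure (Fin d → ℝ)) : Prop where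
  /-- `ν` lives on the cone. -/
  compl_cone : ν (cone d)ᶜ = 0
  ne_zero : ν ≠ 0
  /-- `ν` is finite on `(x,∞)^d` for every `x > 0`. -/
  finite : ∀ x : ℝ, 0 < x → ν {z | ∀ i, x < z i} < ∞
  /-- The ratios below have positive denominators. -/
  min_pos : ∀ x : ℝ, 0 < P {ω | ∀ i, x < Z ω i}
  tendsto : ∀ B : Set (Fin d → ℝ), MeasurableSet B → B ⊆ cone d → BoundedAway B →
    ν (frontier B) = 0 →
      Tendsto (fun x : ℝ => P {ω | Z ω ∈ x • B} / P {ω | ∀ i, x < Z ω i}) atTop (𝓝 (ν B))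
  index_pos : 0 < α
  /-- The index is the order of homogeneity of `ν`. -/
  homogeneous : ∀ c : ℝ, 0 < c → ∀ B : Set (Fin d → ℝ), MeasurableSet B → B ⊆ cone d →
    ν (c • B) = ENNReal.ofReal (c ^ (-α)) * ν B

/-- Strict stationarity of a real time series: its law as a random element of `ℝ^ℤ` is invariant
under time shifts. -/
def Stationary {Ω : Type*} [MeasurableSpace Ω] (P : Measure Ω) (Y : ℤ → Ω → ℝ) : Prop :=
  ∀ h : ℤ, IdentDistrib (fun ω (t : ℤ) => Y (t + h) ω) (fun ω (t : ℤ) => Y t ω) P P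

end ConeRV

/-! This is Breiman's lemma on the open cone. Let `S` be the volatility vector and `E` the
independent innovation vector. Given `E = e`, the event that `E * S` lies in `x • B` says that `S`
lies in `x • {z | e * z ∈ B}`. If all `e i > 0`, regular variation of `S` gives the limit `ν {z | e
* z ∈ B}` after division by P(min S > x). Otherwise that set misses the cone, and both the ratio and
the limit vanish. Integrating over `E` produces `mixture P E ν`.

The crux is exchanging limit and integral. `RegularlyVarying.potter` bounds the ratio by C m^β for β
> α, uniformly in m ≥ 1 and large x. With m = `scale r E`, affine in the positive parts of `E`, the
moment of order β = α + δ supplies an integrable majorant; this is `RegularlyVarying.tendsto_mul`.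
Comparing a general `B` with (1,∞)^d then replaces the normalization by that of min(E * S). This
needs the mixture of (1,∞)^d to be finite, again by the moment, and positive, because the
innovations jointly exceed some η > 0 with positive probability. -/

namespace ConeRV

/-! ### Boxes and homogeneous measures -/

/-- The box `(c,∞)^d`. -/
def box (d : ℕ) (c : ℝ) : Set (Fin d → ℝ) := {z | ∀ i, c < z i}

variable {d : ℕ}

lemma isOpen_box (c : ℝ) : IsOpen (box d c) := by
  have : box d c = ⋂ i, {z | c < z i} := by ext z; simp [box]
  rw [this]
  exact isOpen_iInter_of_finite fun i => isOpen_lt continuous_const (continuous_apply i)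

lemma measurableSet_box (c : ℝ) : MeasurableSet (box d c) := (isOpen_box c).measurableSet

lemma cone_eq_box : cone d = box d 0 := rfl

lemma measurableSet_cone : MeasurableSet (cone d) := measurableSet_box 0

lemma box_anti {a b : ℝ} (h : a ≤ b) : box d b ⊆ box d a := fun _ hz i => h.trans_lt (hz i)

lemma box_subset_cone {c : ℝ} (hc : 0 ≤ c) : box d c ⊆ cone d := box_anti hc

lemma boundedAway_box {c : ℝ} (hc : 0 < c) : BoundedAway (box d c) :=
  ⟨c, hc, fun _ hz i => (hz i).le⟩

lemma mem_smul_set_iff {c : ℝ} (hc : 0 < c) {B : Set (Fin d → ℝ)} {z : Fin d → ℝ} :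
    z ∈ c • B ↔ c⁻¹ • z ∈ B := Set.mem_smul_set_iff_inv_smul_mem₀ hc.ne' _ _

lemma smul_box {c : ℝ} (hc : 0 < c) (x : ℝ) : c • box d x = box d (c * x) := by
  ext z
  rw [mem_smul_set_iff hc]
  simp only [box, mem_ofPred_eq, Pi.smul_apply, smul_eq_mul]
  refine forall_congr' fun i => ?_
  rw [lt_inv_mul_iff₀ hc]

lemma closure_subset_of_le {B : Set (Fin d → ℝ)} {r : ℝ} (h : ∀ z ∈ B, ∀ i, r ≤ z i) :
    ∀ z ∈ closure B, ∀ i, r ≤ z i := by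
  have hcl : IsClosed {z : Fin d → ℝ | ∀ i, r ≤ z i} := by
    have : {z : Fin d → ℝ | ∀ i, r ≤ z i} = ⋂ i, {z | r ≤ z i} := by ext z; simp
    rw [this]
    exact isClosed_iInter fun i => isClosed_le continuous_const (continuous_apply i)
  exact fun z hz => closure_minimal h hcl hz

lemma frontier_subset_cone {B : Set (Fin d → ℝ)} (h : BoundedAway B) : frontier B ⊆ cone d := by
  obtain ⟨r, hr, hB⟩ := h
  exact fun z hz i => hr.trans_le (closure_subset_of_le hB z (frontier_subset_closure hz) i)

/-- Homogeneity of order `-α` on the Borel subsets of the cone. -/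
def Homogeneous (ν : Measure (Fin d → ℝ)) (α : ℝ) : Prop :=
  ∀ c : ℝ, 0 < c → ∀ B : Set (Fin d → ℝ), MeasurableSet B → B ⊆ cone d →
    ν (c • B) = ENNReal.ofReal (c ^ (-α)) * ν B

lemma Homogeneous.measure_box {ν : Measure (Fin d → ℝ)} {α : ℝ} (h : Homogeneous ν α) {c : ℝ}
    (hc : 0 < c) : ν (box d c) = ENNReal.ofReal (c ^ (-α)) * ν (box d 1) := by
  rw [← h c hc _ (measurableSet_box 1) (box_subset_cone zero_le_one), smul_box hc, mul_one]

/-- A homogeneous measure that is finite on boxes does not charge the boundary of a box. -/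
lemma Homogeneous.frontier_box {ν : Measure (Fin d → ℝ)} {α : ℝ} (h : Homogeneous ν α)
    (hfin : ν (box d 1) ≠ ∞) {c : ℝ} (hc : 0 < c) : ν (frontier (box d c)) = 0 := by
  -- For x < c the closure lies in `box d x`, whose mass tends to that of `box d c` as x ↑ c, by
  -- homogeneity.
  have hle : ν (closure (box d c)) ≤ ν (box d c) := by
    have hlim : Tendsto (fun x : ℝ => ENNReal.ofReal (x ^ (-α)) * ν (box d 1)) (𝓝[<] c)
        (𝓝 (ENNReal.ofReal (c ^ (-α)) * ν (box d 1))) := by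
      refine ENNReal.Tendsto.mul_const ?_ (Or.inr hfin)
      refine ENNReal.tendsto_ofReal ?_
      exact ((Real.continuousAt_rpow_const c (-α) (Or.inl hc.ne')).tendsto).mono_left
        nhdsWithin_le_nhds
    rw [h.measure_box hc]
    refine ge_of_tendsto hlim ?_
    filter_upwards [self_mem_nhdsWithin, mem_nhdsWithin_of_mem_nhds (lt_mem_nhds hc)] with x hx hx0
    rw [← h.measure_box hx0]
    refine measure_mono fun z hz i => lt_of_lt_of_le hx ?_
    exact closure_subset_of_le (fun z hz i => (hz i).le) z hz i
  have hne : ν (box d c) ≠ ∞ := by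
    rw [h.measure_box hc]; exact ENNReal.mul_ne_top ENNReal.ofReal_ne_top hfin
  rw [(isOpen_box c).frontier_eq,
    measure_sdiff subset_closure (measurableSet_box c).nullMeasurableSet hne]
  exact tsub_eq_zero_of_le hle

lemma sigmaFinite_of_finite_box {ν : Measure (Fin d → ℝ)} (h0 : ν (cone d)ᶜ = 0)
    (hfin : ∀ x : ℝ, 0 < x → ν (box d x) < ∞) : SigmaFinite ν := by
  refine ⟨⟨⟨fun n : ℕ => box d (1 / (n + 1)) ∪ (cone d)ᶜ, fun _ => trivial, fun n => ?_, ?_⟩⟩⟩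
  · exact (measure_union_le _ _).trans_lt
      (by rw [h0, add_zero]; exact hfin _ Nat.one_div_pos_of_nat)
  · refine eq_univ_of_forall fun z => ?_
    by_cases hz : z ∈ cone d
    · have : ∀ᶠ n : ℕ in atTop, ∀ i, 1 / ((n : ℝ) + 1) < z i :=
        eventually_all.2 fun i => tendsto_one_div_add_atTop_nhds_zero_nat.eventually_lt_const (hz i)
      obtain ⟨n, hn⟩ := this.exists
      exact mem_iUnion.2 ⟨n, Or.inl hn⟩
    · exact mem_iUnion.2 ⟨0, Or.inr hz⟩

/-! ### Potter bounds -/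

/-- A Potter bound for a monotone tail: a doubling estimate near infinity gives a polynomial bound
for `F (x / m) / F x`, uniformly in `m ≥ 1`. -/
lemma potter_bound {F : ℝ → ℝ≥0∞} (hF : Antitone F) (h1 : ∀ x, F x ≤ 1) (h0 : ∀ x, 0 < F x)
    {β : ℝ} (hβ : 0 < β)
    (hdouble : ∀ᶠ x in atTop, F (x / 2) ≤ ENNReal.ofReal (2 ^ β) * F x) :
    ∃ C : ℝ≥0∞, C ≠ ∞ ∧ ∀ᶠ x in atTop, ∀ m : ℝ, 1 ≤ m →
      F (x / m) ≤ C * ENNReal.ofReal (m ^ β) * F x := by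
  obtain ⟨a, ha⟩ := eventually_atTop.1 hdouble
  set x₀ := max a 1 with hx₀
  have hx₀pos : 0 < x₀ := lt_of_lt_of_le one_pos (le_max_right _ _)
  set q := ENNReal.ofReal (2 ^ β) with hq
  have hq1 : 1 ≤ q := by
    rw [hq, ENNReal.one_le_ofReal]; exact Real.one_le_rpow one_le_two hβ.le
  -- With this constant the trivial bound F ≤ 1 suffices for x ≤ 2x₀. For larger x, halving stays
  -- above x₀, so the induction on k can continue.
  set C := (F (2 * x₀))⁻¹ with hC
  have hCtop : C ≠ ∞ := ENNReal.inv_ne_top.2 (h0 _).ne'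
  have hCF : C * F (2 * x₀) = 1 :=
    ENNReal.inv_mul_cancel (h0 _).ne' ((h1 _).trans_lt ENNReal.one_lt_top).ne
  have key : ∀ k : ℕ, ∀ x, x₀ ≤ x → F (x / 2 ^ k) ≤ C * q ^ k * F x := by
    have small : ∀ k : ℕ, ∀ x y, x ≤ 2 * x₀ → F y ≤ C * q ^ k * F x := fun k x y hx =>
      calc F y ≤ 1 := h1 _
        _ = C * 1 * F (2 * x₀) := by rw [mul_one, hCF]
        _ ≤ C * q ^ k * F x := by gcongr; exacts [one_le_pow₀ hq1, hF hx]
    intro k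
    induction k with
    | zero =>
      intro x hx
      rcases le_total x (2 * x₀) with h | h
      · exact small _ _ _ h
      · have : 1 ≤ C := ENNReal.one_le_inv.2 (h1 _)
        simpa using le_mul_of_one_le_left zero_le this
    | succ k ih =>
      intro x hx
      rcases le_total x (2 * x₀) with h | h
      · exact small _ _ _ h
      · calc F (x / 2 ^ (k + 1)) = F (x / 2 / 2 ^ k) := by rw [pow_succ', div_div]
          _ ≤ C * q ^ k * F (x / 2) := ih _ (by linarith)
          _ ≤ C * q ^ k * (q * F x) := by gcongr; exact ha x ((le_max_left _ _).trans hx)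
          _ = C * q ^ (k + 1) * F x := by ring
  refine ⟨C * q, ENNReal.mul_ne_top hCtop ENNReal.ofReal_ne_top, ?_⟩
  filter_upwards [eventually_ge_atTop x₀] with x hx m hm
  have hxpos : 0 < x := hx₀pos.trans_le hx
  -- Here 2^k ≤ m < 2^(k+1); the surplus factor q of rounding up is absorbed in the constant.
  obtain ⟨k, hk, hk'⟩ := exists_nat_pow_near hm one_lt_two
  calc F (x / m) ≤ F (x / 2 ^ (k + 1)) := hF (by gcongr)
    _ ≤ C * q ^ (k + 1) * F x := key _ x hx
    _ = C * q * q ^ k * F x := by ring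
    _ ≤ C * q * ENNReal.ofReal (m ^ β) * F x := by
      gcongr
      rw [hq, ← ENNReal.ofReal_pow (by positivity)]
      refine ENNReal.ofReal_le_ofReal ?_
      rw [← Real.rpow_natCast, ← Real.rpow_mul two_pos.le, mul_comm, Real.rpow_mul two_pos.le,
        Real.rpow_natCast]
      gcongr

section RV

variable {Ω : Type*} [MeasurableSpace Ω] {P : Measure Ω} [IsProbabilityMeasure P]
  {S : Ω → Fin d → ℝ} {α : ℝ} {ν : Measure (Fin d → ℝ)}

/-- For B = (1,∞)^d the defining ratio is identically 1 for x > 0. -/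
lemma RegularlyVarying.measure_box_one (h : RegularlyVarying P S α ν) : ν (box d 1) = 1 := by
  have hh : Homogeneous ν α := h.homogeneous
  have h1 := h.tendsto (box d 1) (measurableSet_box 1) (box_subset_cone zero_le_one)
    (boundedAway_box one_pos) (hh.frontier_box (h.finite 1 one_pos).ne one_pos)
  refine tendsto_nhds_unique h1 (tendsto_const_nhds.congr' ?_)
  filter_upwards [eventually_gt_atTop 0] with x hx
  rw [smul_box hx, mul_one]
  exact (ENNReal.div_self (h.min_pos x).ne' (measure_ne_top _ _)).symm

lemma RegularlyVarying.measure_box (h : RegularlyVarying P S α ν) {c : ℝ} (hc : 0 < c) :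
    ν (box d c) = ENNReal.ofReal (c ^ (-α)) := by
  rw [Homogeneous.measure_box h.homogeneous hc, h.measure_box_one, mul_one]

/-- The ratio of the tails at x/2 and x tends to 2^α < 2^β, which is the doubling estimate. -/
lemma RegularlyVarying.potter (h : RegularlyVarying P S α ν) {β : ℝ} (hβ : α < β) :
    ∃ C : ℝ≥0∞, C ≠ ∞ ∧ ∀ᶠ x in atTop, ∀ m : ℝ, 1 ≤ m →
      P {ω | S ω ∈ box d (x / m)} ≤ C * ENNReal.ofReal (m ^ β) * P {ω | S ω ∈ box d x} := by
  have hh : Homogeneous ν α := h.homogeneous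
  refine potter_bound (F := fun x => P {ω | S ω ∈ box d x})
    (fun x y hxy => measure_mono fun ω hω => box_anti hxy hω) (fun _ => prob_le_one)
    h.min_pos (h.index_pos.trans hβ) ?_
  have hhalf : (0 : ℝ) < 2⁻¹ := by norm_num
  have h1 := h.tendsto (box d 2⁻¹) (measurableSet_box _) (box_subset_cone hhalf.le)
    (boundedAway_box hhalf) (hh.frontier_box (h.finite 1 one_pos).ne hhalf)
  have h2 : ν (box d 2⁻¹) < ENNReal.ofReal (2 ^ β) := by
    rw [h.measure_box hhalf, Real.inv_rpow two_pos.le, Real.rpow_neg two_pos.le, inv_inv]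
    exact (ENNReal.ofReal_lt_ofReal_iff (by positivity)).2
      (Real.rpow_lt_rpow_of_exponent_lt one_lt_two hβ)
  filter_upwards [h1.eventually_lt_const h2, eventually_gt_atTop 0] with x hx hx0
  rw [smul_box hx0, ← div_eq_mul_inv] at hx
  exact (ENNReal.div_le_iff (h.min_pos x).ne' (measure_ne_top _ _)).1 hx.le

end RV

/-! ### The mixture measure -/

section Product

variable {Ω : Type*} [MeasurableSpace Ω]

/-- The mixture over `ω` of the images of `ν` under `z ↦ E ω * z`, restricted to the cone. -/
noncomputable def mixture (P : Measure Ω) (E : Ω → Fin d → ℝ) (ν : Measure (Fin d → ℝ)) :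
    Measure (Fin d → ℝ) :=
  ((P.prod ν).map fun p => E p.1 * p.2).restrict (cone d)

variable {P : Measure Ω} {E : Ω → Fin d → ℝ} {ν : Measure (Fin d → ℝ)}

lemma mixture_apply [SFinite ν] (hE : Measurable E) {B : Set (Fin d → ℝ)} (hB : MeasurableSet B)
    (hBc : B ⊆ cone d) : mixture P E ν B = ∫⁻ ω, ν {z | E ω * z ∈ B} ∂P := by
  have hm : Measurable fun p : Ω × (Fin d → ℝ) => E p.1 * p.2 := by fun_prop
  rw [mixture, Measure.restrict_eq_self _ hBc, Measure.map_apply hm hB,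
    Measure.prod_apply (hm hB)]
  rfl

lemma mixture_compl_cone : mixture P E ν (cone d)ᶜ = 0 := by
  rw [mixture, Measure.restrict_apply measurableSet_cone.compl, compl_inter_self, measure_empty]

lemma mixture_homogeneous [SFinite ν] (hE : Measurable E) (h0 : ν (cone d)ᶜ = 0) {α : ℝ}
    (hν : Homogeneous ν α) : Homogeneous (mixture P E ν) α := by
  intro c hc B hB hBc
  have hcB : c • B ⊆ cone d := by
    have := smul_set_mono (a := c) hBc
    rwa [cone_eq_box, smul_box hc, mul_zero] at this
  rw [mixture_apply hE hB hBc, mixture_apply hE (hB.const_smul₀ c) hcB,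
    ← lintegral_const_mul' _ _ ENNReal.ofReal_ne_top]
  refine lintegral_congr fun ω => ?_
  have hm : Measurable fun z => E ω * z := by fun_prop
  have e1 : ∀ A : Set (Fin d → ℝ), ν A = ν (A ∩ cone d) := fun A =>
    (measure_inter_conull h0).symm
  have hmB : MeasurableSet {z | E ω * z ∈ B} := hm hB
  -- Negative coordinates of `E ω` can put part of the preimage outside the cone, where homogeneity
  -- is not assumed; that part is null.
  rw [e1, e1 {z | E ω * z ∈ B},
    ← hν c hc _ (hmB.inter measurableSet_cone) inter_subset_right]
  congr 1
  ext z
  rw [mem_smul_set_iff hc, mem_inter_iff, mem_inter_iff, mem_ofPred_eq, mem_ofPred_eq,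
    mem_smul_set_iff hc, mul_smul_comm, ← mem_smul_set_iff hc (B := cone d), cone_eq_box,
    smul_box hc, mul_zero]

lemma frontier_preimage_mul {e : Fin d → ℝ} (he : e ∈ cone d) (B : Set (Fin d → ℝ)) :
    frontier {z | e * z ∈ B} = {z | e * z ∈ frontier B} :=
  ((Homeomorph.piCongrRight fun i => Homeomorph.mulLeft₀ (e i) (he i).ne').preimage_frontier B).symm

/-- A scalar that dominates the positive parts of the coordinates of `e`. -/
noncomputable def scale (r : ℝ) (e : Fin d → ℝ) : ℝ := 1 + ∑ i, (e i)⁺ / r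

lemma one_le_scale {r : ℝ} (hr : 0 < r) (e : Fin d → ℝ) : 1 ≤ scale r e :=
  le_add_of_nonneg_right (Finset.sum_nonneg fun _ _ => div_nonneg (posPart_nonneg _) hr.le)

lemma lt_scale_mul {r : ℝ} (hr : 0 < r) (e : Fin d → ℝ) (i : Fin d) : e i < scale r e * r := by
  have h1 : (e i)⁺ / r ≤ ∑ j, (e j)⁺ / r :=
    Finset.single_le_sum (f := fun j => (e j)⁺ / r)
      (fun j _ => div_nonneg (posPart_nonneg _) hr.le) (Finset.mem_univ i)
  rw [div_le_iff₀ hr] at h1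
  have h2 := le_posPart (e i)
  have : scale r e * r = r + (∑ j, (e j)⁺ / r) * r := by rw [scale]; ring
  linarith

lemma mem_cone_of_mul {e z : Fin d → ℝ} (hz : z ∈ cone d) (h : e * z ∈ cone d) : e ∈ cone d :=
  fun i => (pos_iff_pos_of_mul_pos (h i)).2 (hz i)

/-- This inclusion yields the majorant: a large product forces every coordinate of z above a
fraction of x that depends on e only through `scale r e`. -/
lemma mem_box_of_le_mul {r : ℝ} (hr : 0 < r) {x : ℝ} {e z : Fin d → ℝ}
    (hz : z ∈ cone d) (h : ∀ i, x * r ≤ e i * z i) : z ∈ box d (x / scale r e) := by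
  intro i
  have hs := one_le_scale hr e
  rw [div_lt_iff₀ (by linarith)]
  have h1 : e i * z i < scale r e * r * z i := mul_lt_mul_of_pos_right (lt_scale_mul hr e i) (hz i)
  have h2 : x * r < (z i * scale r e) * r := by linarith [h i]
  exact lt_of_mul_lt_mul_right h2 hr.le

lemma upperBox_div_eq {s e : Fin d → ℝ} (hs : ∀ i, 0 < s i) :
    upperBox (fun i => ENNReal.ofReal (s i) / ENNReal.ofReal (e i)⁺) =
      {z | e * z ∈ {y | ∀ i, s i < y i}} ∩ cone d := by
  have key : ∀ a b z : ℝ, 0 < a →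
      (ENNReal.ofReal a / ENNReal.ofReal b⁺ < ENNReal.ofReal z ↔ a < b * z ∧ 0 < z) := by
    intro a b z ha
    -- For b ≤ 0 the corner is a/0 = ∞, and a < b * z fails for every z > 0, so both sides are
    -- false.
    rcases le_or_gt b 0 with hb | hb
    · rw [posPart_eq_zero.2 hb, ENNReal.ofReal_zero, ENNReal.div_zero (by simpa using ha)]
      refine ⟨fun h => (not_top_lt h).elim, fun h => ?_⟩
      nlinarith [mul_nonneg (neg_nonneg.2 hb) h.2.le]
    · rw [posPart_of_nonneg hb.le, ← ENNReal.ofReal_div_of_pos hb,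
        ENNReal.ofReal_lt_ofReal_iff_of_nonneg (by positivity), div_lt_iff₀ hb, mul_comm]
      exact ⟨fun h => ⟨h, pos_of_mul_pos_right (ha.trans h) hb.le⟩, fun h => h.1⟩
  ext z
  simp only [upperBox, cone, mem_ofPred_eq, mem_inter_iff, key _ _ _ (hs _), Pi.mul_apply,
    forall_and]

lemma mixture_upperBox [SFinite ν] (hE : Measurable E) (h0 : ν (cone d)ᶜ = 0) {s : Fin d → ℝ}
    (hs : ∀ i, 0 < s i) :
    mixture P E ν (upperBox fun i => ENNReal.ofReal (s i)) =
      ∫⁻ ω, ν (upperBox fun i => ENNReal.ofReal (s i) / ENNReal.ofReal (E ω i)⁺) ∂P := by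
  have h1 : (upperBox fun i => ENNReal.ofReal (s i)) = {y : Fin d → ℝ | ∀ i, s i < y i} := by
    ext z
    simp only [upperBox, mem_ofPred_eq, ENNReal.ofReal_lt_ofReal_iff_of_nonneg (hs _).le]
  have hmeas : MeasurableSet {y : Fin d → ℝ | ∀ i, s i < y i} := by
    have : {y : Fin d → ℝ | ∀ i, s i < y i} = ⋂ i, {y | s i < y i} := by ext z; simp
    rw [this]
    exact MeasurableSet.iInter fun i => measurableSet_lt measurable_const (measurable_pi_apply i)
  rw [h1, mixture_apply hE hmeas fun y hy i => (hs i).trans (hy i)]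
  refine lintegral_congr fun ω => ?_
  rw [upperBox_div_eq hs, measure_inter_conull h0]

variable [IsProbabilityMeasure P]

lemma lintegral_scale_rpow_lt_top {β : ℝ} (hβ : 0 < β) (hE : Measurable E)
    (hmom : ∀ i, ∫⁻ ω, ENNReal.ofReal ((E ω i)⁺ ^ β) ∂P < ∞) {r : ℝ} (hr : 0 < r) :
    ∫⁻ ω, ENNReal.ofReal (scale r (E ω) ^ β) ∂P < ∞ := by
  have hp0 : ENNReal.ofReal β ≠ 0 := by simpa using hβ
  have hEi : ∀ i, Measurable fun ω => (E ω i)⁺ := fun i => by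
    simp only [posPart_def]; fun_prop
  have hmem : ∀ i, MemLp (fun ω => (E ω i)⁺) (ENNReal.ofReal β) P := fun i => by
    refine ⟨(hEi i).aestronglyMeasurable, ?_⟩
    rw [eLpNorm_lt_top_iff_lintegral_rpow_enorm_lt_top hp0 ENNReal.ofReal_ne_top,
      ENNReal.toReal_ofReal hβ.le]
    refine (lintegral_congr fun ω => ?_).trans_lt (hmom i)
    rw [Real.enorm_of_nonneg (posPart_nonneg _), ENNReal.ofReal_rpow_of_nonneg (posPart_nonneg _) hβ.le]
  have hs : MemLp (fun ω => scale r (E ω)) (ENNReal.ofReal β) P := by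
    refine (memLp_const (1 : ℝ)).add (memLp_finsetSum _ fun i _ => ?_)
    simpa only [div_eq_mul_inv] using (hmem i).mul_const r⁻¹
  have := (eLpNorm_lt_top_iff_lintegral_rpow_enorm_lt_top hp0 ENNReal.ofReal_ne_top).1 hs.2
  rw [ENNReal.toReal_ofReal hβ.le] at this
  refine (lintegral_congr fun ω => ?_).trans_lt this
  have hn : 0 ≤ scale r (E ω) := zero_le_one.trans (one_le_scale hr _)
  rw [Real.enorm_of_nonneg hn, ENNReal.ofReal_rpow_of_nonneg hn hβ.le]

variable {S : Ω → Fin d → ℝ} {α : ℝ}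

/-! ### Breiman's lemma and the limit measure -/

/-- Breiman's lemma on the cone: the tail of the product, normalized by the tail of
the minimum of `S`, converges to the mixture. -/
lemma RegularlyVarying.tendsto_mul (h : RegularlyVarying P S α ν) (hS : Measurable S)
    (hE : Measurable E) (hSE : IndepFun S E P) (hpos : ∀ᵐ ω ∂P, S ω ∈ cone d) {β : ℝ} (hβ : α < β)
    (hmom : ∀ i, ∫⁻ ω, ENNReal.ofReal ((E ω i)⁺ ^ β) ∂P < ∞) {B : Set (Fin d → ℝ)}
    (hB : MeasurableSet B) (hBc : B ⊆ cone d) (hBa : BoundedAway B)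
    (hfr : mixture P E ν (frontier B) = 0) :
    Tendsto (fun x : ℝ => P {ω | E ω * S ω ∈ x • B} / P {ω | S ω ∈ box d x}) atTop
      (𝓝 (mixture P E ν B)) := by
  have : SigmaFinite ν := sigmaFinite_of_finite_box h.compl_cone h.finite
  obtain ⟨r, hr, hBr⟩ := id hBa
  obtain ⟨C, hC, hpot⟩ := h.potter hβ
  have hm : Measurable fun p : (Fin d → ℝ) × (Fin d → ℝ) => p.2 * p.1 := by fun_prop
  have hlaw : ∀ A, MeasurableSet A →
      P {ω | E ω * S ω ∈ A} = ∫⁻ ω, P {ω' | E ω * S ω' ∈ A} ∂P := fun A hA => by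
    have h1 := (indepFun_iff_map_prod_eq_prod_map_map hS.aemeasurable hE.aemeasurable).1 hSE
    have h2 : P {ω | E ω * S ω ∈ A} =
        (P.map fun ω => (S ω, E ω)) ((fun p : (Fin d → ℝ) × (Fin d → ℝ) => p.2 * p.1) ⁻¹' A) := by
      rw [Measure.map_apply (hS.prodMk hE) (hm hA)]; rfl
    have := Measure.isProbabilityMeasure_map (μ := P) hS.aemeasurable
    have := Measure.isProbabilityMeasure_map (μ := P) hE.aemeasurable
    rw [h2, h1, Measure.prod_apply_symm (hm hA),
      lintegral_map (measurable_measure_prodMk_right (hm hA)) hE]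
    refine lintegral_congr fun ω => ?_
    rw [Measure.map_apply hS (measurable_prodMk_right (hm hA))]
    rfl
  have hmeas : ∀ A : Set (Fin d → ℝ), MeasurableSet A →
      Measurable fun ω => P {ω' | E ω * S ω' ∈ A} := fun A hA =>
    measurable_measure_prodMk_left (ν := P) (s := {p : Ω × Ω | E p.1 * S p.2 ∈ A})
      (((hE.comp measurable_fst).mul (hS.comp measurable_snd)) hA)
  have hlim : Tendsto (fun x : ℝ => ∫⁻ ω, P {ω' | E ω * S ω' ∈ x • B} / P {ω | S ω ∈ box d x} ∂P)
      atTop (𝓝 (∫⁻ ω, ν {z | E ω * z ∈ B} ∂P)) := by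
    refine tendsto_lintegral_filter_of_dominated_convergence
      (fun ω => C * ENNReal.ofReal (scale r (E ω) ^ β)) ?_ ?_ ?_ ?_
    · exact Eventually.of_forall fun x => (hmeas _ (hB.const_smul₀ x)).div_const _
    · filter_upwards [hpot, eventually_gt_atTop 0] with x hx hx0
      refine Eventually.of_forall fun ω => ?_
      refine ENNReal.div_le_of_le_mul (le_trans ?_ (hx _ (one_le_scale hr (E ω))))
      refine measure_mono_ae ?_
      filter_upwards [hpos] with ω' hω' hmem
      refine mem_box_of_le_mul hr hω' fun i => ?_
      have := hBr _ ((mem_smul_set_iff hx0).1 hmem) i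
      rw [Pi.smul_apply, smul_eq_mul, le_inv_mul_iff₀ hx0] at this
      exact this
    · rw [lintegral_const_mul' _ _ hC]
      exact ENNReal.mul_ne_top hC
        (lintegral_scale_rpow_lt_top (h.index_pos.trans hβ) hE hmom hr).ne
    -- A frontier that is null for the mixture is null for almost every fibre.
    · have hfr' : ∀ᵐ ω ∂P, ν {z | E ω * z ∈ frontier B} = 0 := by
        rw [mixture_apply hE measurableSet_frontier (frontier_subset_cone hBa)] at hfr
        refine (lintegral_eq_zero_iff ?_).1 hfr
        exact measurable_measure_prodMk_left (ν := ν)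
          (s := {p : Ω × (Fin d → ℝ) | E p.1 * p.2 ∈ frontier B})
          (((hE.comp measurable_fst).mul measurable_snd) measurableSet_frontier)
      filter_upwards [hfr'] with ω hω
      by_cases he : E ω ∈ cone d
      · have hsub : {z | E ω * z ∈ B} ⊆ cone d := fun z hz i =>
          (pos_iff_pos_of_mul_pos (hBc hz i)).1 (he i)
        have hbd : BoundedAway {z | E ω * z ∈ B} := by
          refine ⟨1 / scale r (E ω), one_div_pos.2 (one_pos.trans_le (one_le_scale hr _)),
            fun z hz i => ?_⟩
          refine (mem_box_of_le_mul hr (hsub hz) (fun j => ?_) i).le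
          rw [one_mul]; exact hBr _ hz j
        have hmz : Measurable fun z => E ω * z := by fun_prop
        refine (h.tendsto {z | E ω * z ∈ B} (hmz hB) hsub hbd
          (by rwa [frontier_preimage_mul he])).congr' ?_
        filter_upwards [eventually_gt_atTop 0] with x hx0
        congr 2
        ext ω'
        rw [mem_ofPred_eq, mem_ofPred_eq, mem_smul_set_iff hx0, mem_smul_set_iff hx0, mem_ofPred_eq,
          mul_smul_comm]
      · have hν0 : ν {z | E ω * z ∈ B} = 0 := measure_mono_null
          (fun z hz hzc => he (mem_cone_of_mul hzc (hBc hz))) h.compl_cone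
        rw [hν0]
        refine tendsto_const_nhds.congr' ?_
        filter_upwards [eventually_gt_atTop 0] with x hx0
        have : P {ω' | E ω * S ω' ∈ x • B} = 0 := by
          rw [measure_eq_zero_iff_ae_notMem]
          filter_upwards [hpos] with ω' hω' hmem
          refine he (mem_cone_of_mul hω' ?_)
          have := hBc ((mem_smul_set_iff hx0).1 hmem)
          rwa [← mem_smul_set_iff hx0, cone_eq_box, smul_box hx0, mul_zero] at this
        rw [this, ENNReal.zero_div]
  rw [mixture_apply hE hB hBc]
  refine hlim.congr fun x => ?_
  simp only [div_eq_mul_inv]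
  rw [lintegral_mul_const _ (hmeas _ (hB.const_smul₀ x)), ← hlaw _ (hB.const_smul₀ x)]

lemma mixture_box_one_lt_top (h : RegularlyVarying P S α ν) (hE : Measurable E) {β : ℝ}
    (hβ : α < β) (hmom : ∀ i, ∫⁻ ω, ENNReal.ofReal ((E ω i)⁺ ^ β) ∂P < ∞) :
    mixture P E ν (box d 1) < ∞ := by
  have : SigmaFinite ν := sigmaFinite_of_finite_box h.compl_cone h.finite
  rw [mixture_apply hE (measurableSet_box 1) (box_subset_cone zero_le_one)]
  refine (lintegral_mono fun ω => ?_).trans_lt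
    (lintegral_scale_rpow_lt_top (h.index_pos.trans hβ) hE hmom one_pos)
  have hs := one_le_scale one_pos (E ω)
  have hs0 : 0 < scale 1 (E ω) := one_pos.trans_le hs
  calc ν {z | E ω * z ∈ box d 1} ≤ ν (box d (1 / scale 1 (E ω))) := by
        refine measure_mono_ae ?_
        filter_upwards [compl_mem_ae_iff.2 h.compl_cone] with z hz hmem
        exact mem_box_of_le_mul one_pos (not_not.1 hz) fun i => by
          rw [mul_one]; exact (hmem i).le
    _ = ENNReal.ofReal (scale 1 (E ω) ^ α) := by
        rw [h.measure_box (one_div_pos.2 hs0), one_div, Real.inv_rpow hs0.le,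
          Real.rpow_neg hs0.le, inv_inv]
    _ ≤ ENNReal.ofReal (scale 1 (E ω) ^ β) :=
        ENNReal.ofReal_le_ofReal (Real.rpow_le_rpow_of_exponent_le hs hβ.le)

/-- On the event that `E` lies in (η,∞)^d, the preimage of (1,∞)^d contains (1/η,∞)^d, which has
positive mass. -/
lemma mixture_box_one_pos (h : RegularlyVarying P S α ν) (hE : Measurable E) {η : ℝ} (hη : 0 < η)
    (hpos : 0 < P {ω | E ω ∈ box d η}) : 0 < mixture P E ν (box d 1) := by
  have : SigmaFinite ν := sigmaFinite_of_finite_box h.compl_cone h.finite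
  rw [mixture_apply hE (measurableSet_box 1) (box_subset_cone zero_le_one)]
  have hA : MeasurableSet {ω | E ω ∈ box d η} := hE (measurableSet_box η)
  have h1 : 0 < ν (box d η⁻¹) := by
    rw [h.measure_box (inv_pos.2 hη)]
    exact ENNReal.ofReal_pos.2 (by positivity)
  refine (ENNReal.mul_pos h1.ne' hpos.ne').trans_le ?_
  rw [← setLIntegral_const]
  refine (setLIntegral_mono' hA fun ω hω => ?_).trans (setLIntegral_le_lintegral _ _)
  refine measure_mono fun z hz i => ?_
  have h2 := mul_lt_mul'' (hω i) (hz i) hη.le (inv_pos.2 hη).le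
  rwa [mul_inv_cancel₀ hη.ne'] at h2

/-- Multiplication by an independent vector with enough moments preserves regular variation on the
cone and its index; the limit measure is the normalized mixture. -/
lemma RegularlyVarying.mul (h : RegularlyVarying P S α ν) (hS : Measurable S)
    (hE : Measurable E) (hSE : IndepFun S E P) (hpos : ∀ᵐ ω ∂P, S ω ∈ cone d) {β : ℝ} (hβ : α < β)
    (hmom : ∀ i, ∫⁻ ω, ENNReal.ofReal ((E ω i)⁺ ^ β) ∂P < ∞)
    (hD0 : 0 < mixture P E ν (box d 1)) :
    RegularlyVarying P (fun ω => E ω * S ω) α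
      ((mixture P E ν (box d 1))⁻¹ • mixture P E ν) := by
  have : SigmaFinite ν := sigmaFinite_of_finite_box h.compl_cone h.finite
  have hD := mixture_box_one_lt_top h hE hβ hmom
  have hhom : Homogeneous (mixture P E ν) α := mixture_homogeneous hE h.compl_cone h.homogeneous
  set D := mixture P E ν (box d 1) with hDdef
  have hDinv : D⁻¹ ≠ ∞ := ENNReal.inv_ne_top.2 hD0.ne'
  have hbox : Tendsto (fun x : ℝ => P {ω | E ω * S ω ∈ box d x} / P {ω | S ω ∈ box d x}) atTop
      (𝓝 D) := by
    refine (h.tendsto_mul hS hE hSE hpos hβ hmom (measurableSet_box 1)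
      (box_subset_cone zero_le_one) (boundedAway_box one_pos)
      (hhom.frontier_box hD.ne one_pos)).congr' ?_
    filter_upwards [eventually_gt_atTop 0] with x hx
    rw [smul_box hx, mul_one]
  -- The positive limit D gives positivity only for large y; monotonicity carries it down to every
  -- x.
  have hmin : ∀ x : ℝ, 0 < P {ω | E ω * S ω ∈ box d x} := fun x => by
    obtain ⟨y, hy, hxy⟩ := ((hbox.eventually_const_lt hD0).and (eventually_ge_atTop x)).exists
    exact (ENNReal.div_pos_iff.1 hy).1.bot_lt.trans_le (measure_mono fun ω hω => box_anti hxy hω)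
  refine ⟨?_, ?_, ?_, hmin, ?_, h.index_pos, ?_⟩
  · rw [Measure.smul_apply, mixture_compl_cone, smul_zero]
  · intro h0
    have := congrArg (fun m : Measure (Fin d → ℝ) => m (box d 1)) h0
    simp only [Measure.smul_apply, smul_eq_mul, ← hDdef, Measure.coe_zero, Pi.zero_apply] at this
    rw [ENNReal.inv_mul_cancel hD0.ne' hD.ne] at this
    exact one_ne_zero this
  · intro x hx
    change (D⁻¹ • mixture P E ν) (box d x) < ∞
    rw [Measure.smul_apply, smul_eq_mul, hhom.measure_box hx]
    exact ENNReal.mul_lt_top hDinv.lt_top (ENNReal.mul_lt_top ENNReal.ofReal_lt_top hD)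
  · intro B hB hBc hBa hfr
    have hfr' : mixture P E ν (frontier B) = 0 := by
      rw [Measure.smul_apply, smul_eq_mul, mul_eq_zero] at hfr
      exact hfr.resolve_left (ENNReal.inv_ne_zero.2 hD.ne)
    have h1 := h.tendsto_mul hS hE hSE hpos hβ hmom hB hBc hBa hfr'
    have h2 := ENNReal.Tendsto.div h1 (Or.inr hD0.ne') hbox (Or.inl hD.ne)
    rw [Measure.smul_apply, smul_eq_mul, mul_comm, ← div_eq_mul_inv]
    refine h2.congr fun x => ?_
    simp only [div_eq_mul_inv _ (P {ω | S ω ∈ box d x})]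
    exact ENNReal.mul_div_mul_right _ _ (ENNReal.inv_ne_zero.2 (measure_ne_top _ _))
      (ENNReal.inv_ne_top.2 (h.min_pos x).ne')
  · intro c hc B hB hBc
    rw [Measure.smul_apply, Measure.smul_apply, hhom c hc B hB hBc, smul_eq_mul, smul_eq_mul,
      mul_left_comm]

end Product

/-! ### Innovations and the theorem -/

/-- If i.i.d. innovations are positive with positive probability, then some `η > 0` is exceeded by
any finite subfamily simultaneously with positive probability. -/
lemma exists_pos_measure_box {Ω : Type*} [MeasurableSpace Ω] {P : Measure Ω}
    {ι : Type*} {ε : ι → Ω → ℝ} (hind : iIndepFun ε P) {k : ι}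
    (hident : ∀ t, IdentDistrib (ε t) (ε k) P P) (h0 : 0 < P {ω | 0 < ε k ω}) (t : Fin d → ι) :
    ∃ η : ℝ, 0 < η ∧ 0 < P {ω | (fun i => ε (t i) ω) ∈ box d η} := by
  classical
  obtain ⟨n, hn⟩ : ∃ n : ℕ, 0 < P {ω | 1 / ((n : ℝ) + 1) < ε k ω} := by
    by_contra! hcon
    refine h0.ne' (measure_mono_null (fun ω (hω : 0 < ε k ω) => ?_)
      (measure_iUnion_null fun n => nonpos_iff_eq_zero.1 (hcon n)))
    obtain ⟨n, hn⟩ := exists_nat_one_div_lt hω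
    exact mem_iUnion.2 ⟨n, hn⟩
  refine ⟨1 / ((n : ℝ) + 1), Nat.one_div_pos_of_nat, ?_⟩
  set η := 1 / ((n : ℝ) + 1)
  -- The times `t i` may repeat, so independence is applied over the set of distinct times.
  have hsub : (⋂ j ∈ Finset.univ.image t, ε j ⁻¹' Ioi η) ⊆
      {ω | (fun i => ε (t i) ω) ∈ box d η} := fun ω hω i =>
    mem_iInter₂.1 hω (t i) (Finset.mem_image_of_mem t (Finset.mem_univ i))
  refine lt_of_lt_of_le ?_ (measure_mono hsub)
  rw [hind.measure_inter_preimage_eq_mul _ fun _ _ => measurableSet_Ioi]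
  refine pos_iff_ne_zero.2 (Finset.prod_ne_zero_iff.2 fun j _ => ?_)
  rw [(hident j).measure_preimage_eq measurableSet_Ioi]
  exact hn.ne'

end ConeRV

theorem mainTheorem7 {Ω : Type*} [MeasurableSpace Ω] (P : Measure Ω) [IsProbabilityMeasure P]
    (σ ε X : ℤ → Ω → ℝ)
    (hσ_meas : ∀ t, Measurable (σ t)) (hε_meas : ∀ t, Measurable (ε t))
    (hX : ∀ t ω, X t ω = σ t ω * ε t ω)
    (hσ_stat : ConeRV.Stationary P σ)
    (hσ_pos : ∀ t, ∀ᵐ ω ∂P, 0 < σ t ω)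
    (hε_indep : iIndepFun ε P) (hε_ident : ∀ t, IdentDistrib (ε t) (ε 0) P P)
    (hσε : IndepFun (fun ω (t : ℤ) => σ t ω) (fun ω (t : ℤ) => ε t ω) P)
    (d : ℕ) (hd : 0 < d) (t : Fin d → ℤ)
    (α : ℝ) (νσ : Measure (Fin d → ℝ))
    (hRV : ConeRV.RegularlyVarying P (fun ω i => σ (t i) ω) α νσ)
    (δ : ℝ) (hδ : 0 < δ)
    (hmom_pos : 0 < ∫⁻ ω, ENNReal.ofReal ((ε 0 ω)⁺ ^ (α + δ)) ∂P)
    (hmom_fin : ∫⁻ ω, ENNReal.ofReal ((ε 0 ω)⁺ ^ (α + δ)) ∂P < ∞) :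
    -- the normalizing expectation is positive and finite
    (0 < ∫⁻ ω, νσ (ConeRV.upperBox fun i => 1 / ENNReal.ofReal (ε (t i) ω)⁺) ∂P) ∧
    (∫⁻ ω, νσ (ConeRV.upperBox fun i => 1 / ENNReal.ofReal (ε (t i) ω)⁺) ∂P < ∞) ∧
    ∃ νX : Measure (Fin d → ℝ),
      ConeRV.RegularlyVarying P (fun ω i => X (t i) ω) α νX ∧
      ∀ s : Fin d → ℝ, (∀ i, 0 < s i) →
        νX (ConeRV.upperBox fun i => ENNReal.ofReal (s i)) =
          (∫⁻ ω, νσ (ConeRV.upperBox fun i =>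
              ENNReal.ofReal (s i) / ENNReal.ofReal (ε (t i) ω)⁺) ∂P) /
          (∫⁻ ω, νσ (ConeRV.upperBox fun i => 1 / ENNReal.ofReal (ε (t i) ω)⁺) ∂P) := by
  have hα : α < α + δ := lt_add_of_pos_right α hδ
  set E : Ω → Fin d → ℝ := fun ω i => ε (t i) ω with hEdef
  set S : Ω → Fin d → ℝ := fun ω i => σ (t i) ω with hSdef
  have hE : Measurable E := measurable_pi_lambda _ fun i => hε_meas (t i)
  have hS : Measurable S := measurable_pi_lambda _ fun i => hσ_meas (t i)
  have hSE : IndepFun S E P :=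
    hσε.comp (φ := fun (y : ℤ → ℝ) i => y (t i)) (ψ := fun (y : ℤ → ℝ) i => y (t i))
      (by fun_prop) (by fun_prop)
  have hpos : ∀ᵐ ω ∂P, S ω ∈ ConeRV.cone d := ae_all_iff.2 fun i => hσ_pos (t i)
  have hmom : ∀ i, ∫⁻ ω, ENNReal.ofReal ((E ω i)⁺ ^ (α + δ)) ∂P < ∞ := fun i => by
    have hu : Measurable fun y : ℝ => ENNReal.ofReal (y⁺ ^ (α + δ)) := by
      simp only [posPart_def]; fun_prop
    exact (((hε_ident (t i)).comp hu).lintegral_eq).trans_lt hmom_fin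
  have hε0 : 0 < P {ω | 0 < ε 0 ω} := by
    refine pos_iff_ne_zero.2 fun h0 => hmom_pos.ne' ?_
    have hae : ∀ᵐ ω ∂P, ¬ 0 < ε 0 ω := by rw [ae_iff]; simpa using h0
    refine (lintegral_congr_ae ?_).trans lintegral_zero
    filter_upwards [hae] with ω hω
    rw [posPart_eq_zero.2 (not_lt.1 hω), Real.zero_rpow (by linarith [hRV.index_pos]),
      ENNReal.ofReal_zero]
  obtain ⟨η, hη, hηE⟩ := ConeRV.exists_pos_measure_box hε_indep hε_ident hε0 t
  have : SigmaFinite νσ := ConeRV.sigmaFinite_of_finite_box hRV.compl_cone hRV.finite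
  have hbox : ConeRV.box d 1 = ConeRV.upperBox fun _ => ENNReal.ofReal 1 := by
    ext z
    simp only [ConeRV.box, ConeRV.upperBox, mem_ofPred_eq,
      ENNReal.ofReal_lt_ofReal_iff_of_nonneg zero_le_one]
  have hD : ∫⁻ ω, νσ (ConeRV.upperBox fun i => 1 / ENNReal.ofReal (ε (t i) ω)⁺) ∂P =
      ConeRV.mixture P E νσ (ConeRV.box d 1) := by
    rw [hbox, ConeRV.mixture_upperBox hE hRV.compl_cone fun _ => one_pos]
    simp only [ENNReal.ofReal_one, hEdef]
  have hD0 := ConeRV.mixture_box_one_pos hRV hE hη hηE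
  rw [hD]
  refine ⟨hD0, ConeRV.mixture_box_one_lt_top hRV hE hα hmom,
    (ConeRV.mixture P E νσ (ConeRV.box d 1))⁻¹ • ConeRV.mixture P E νσ, ?_, fun s hs => ?_⟩
  · have hXE : (fun ω i => X (t i) ω) = fun ω => E ω * S ω := by
      ext ω i
      rw [hX, mul_comm]; rfl
    rw [hXE]
    exact hRV.mul hS hE hSE hpos hα hmom hD0
  · rw [Measure.smul_apply, smul_eq_mul, mul_comm, ← div_eq_mul_inv,
      ConeRV.mixture_upperBox hE hRV.compl_cone hs]
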